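/- Let $\mathcal A$ be a Grothendieck category, that is, an abelian category with a generator, with arbitrary (small) coproducts, and in which filtered colimits are exact. Let $\mathcal S\subseteq\mathcal A$ be a Serre subcategory, that is, a nonempty full subcategory, closed under isomorphisms, which is closed under subobjects, quotient objects and extensions. Let $\mathcal A/\mathcal S$ be the quotient category, obtained from $\mathcal A$ by inverting all morphisms whose kernel and cokernel lie in $\mathcal S$, and let $Q:\mathcal A\to\mathcal A/\mathcal S$ be the quotient functor. If $\mathcal S$ is colocalizing, i.e. $Q$ has a left adjoint, then $\mathcal S$ is localizing, i.e. $Q$ has a right adjoint. -/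

import Mathlib

universe w v u

open CategoryTheory

namespace CategoryTheory.ObjectProperty

variable {A : Type u} [Category.{v} A] [Abelian A] (S : ObjectProperty A) [S.IsSerreClass]

/-- The quotient category `A / S` of an abelian category `A` by a Serre subcategory `S`:
the category obtained from `A` by formally inverting all morphisms whose kernel and cokernel
both belong to `S`. -/
abbrev SerreQuotient : Type u := S.isoModSerre.Localization

/-- The quotient functor `Q : A ⥤ A / S`. -/
abbrev serreQuotientFunctor : A ⥤ S.SerreQuotient := S.isoModSerre.Q

/-- A Serre subcategory `S` of `A` is localizing if the quotient functor `Q : A ⥤ A / S` has a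
right adjoint, that is, if `Q` is a left adjoint. -/
def IsLocalizing : Prop := S.serreQuotientFunctor.IsLeftAdjoint

/-- A Serre subcategory `S` of `A` is colocalizing if the quotient functor `Q : A ⥤ A / S` has a
left adjoint, that is, if `Q` is a right adjoint. -/
def IsColocalizing : Prop := S.serreQuotientFunctor.IsRightAdjoint

end CategoryTheory.ObjectProperty

namespace CategoryTheory

open Limits

namespace Limits

open CoproductsFromFiniteFiltered

variable {C : Type u} [Category.{v} C]

/-! A right adjoint `Q` preserves products, so `S`, the class of objects that `Q` kills, is closed
under products (`prop_pi`). By AB5 coproducts embed in products, so `S` is also closed under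
coproducts. Calculus of fractions then shows that `Q` preserves coproducts; being right exact, it
preserves all colimits, and the special adjoint functor theorem applies. -/

/-- The canonical morphism from a coproduct to the product of the same family. -/
noncomputable def sigmaToPi [HasZeroMorphisms C] {J : Type w} [DecidableEq J] (X : J → C)
    [HasCoproduct X] [HasProduct X] : ∐ X ⟶ ∏ᶜ X :=
  Sigma.desc fun i ↦ Pi.lift fun j ↦ if h : i = j then eqToHom (by rw [h]) else 0

lemma ι_sigmaToPi_π_self [HasZeroMorphisms C] {J : Type w} [DecidableEq J] (X : J → C)
    [HasCoproduct X] [HasProduct X] (i : J) :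
    Sigma.ι X i ≫ sigmaToPi X ≫ Pi.π X i = 𝟙 _ := by
  simp [sigmaToPi]

lemma ι_sigmaToPi_π_of_ne [HasZeroMorphisms C] {J : Type w} [DecidableEq J] (X : J → C)
    [HasCoproduct X] [HasProduct X] {i j : J} (h : i ≠ j) :
    Sigma.ι X i ≫ sigmaToPi X ≫ Pi.π X j = 0 := by
  simp [sigmaToPi, h]

/-- For finite `K`, summing projection-then-inclusion over `K` gives a retraction. -/
lemma mono_sigmaDesc_comp_sigmaToPi [Preadditive C] {J : Type w} [DecidableEq J] (X : J → C)
    [HasCoproduct X] [HasProduct X] {K : Type*} [Finite K] (f : K → J) (hf : f.Injective)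
    [HasCoproduct fun k ↦ X (f k)] :
    Mono (Sigma.desc (fun k ↦ Sigma.ι X (f k)) ≫ sigmaToPi X) := by
  classical
  have := Fintype.ofFinite K
  have h : (Sigma.desc (fun k ↦ Sigma.ι X (f k)) ≫ sigmaToPi X) ≫
      (∑ k, Pi.π X (f k) ≫ Sigma.ι (fun k ↦ X (f k)) k) = 𝟙 _ := by
    refine Sigma.hom_ext _ _ fun y ↦ ?_
    simp only [Preadditive.comp_sum, Category.assoc, Sigma.ι_desc_assoc, Category.comp_id]
    rw [Finset.sum_eq_single y, reassoc_of% ι_sigmaToPi_π_self X (f y)]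
    · intro x _ hx
      rw [reassoc_of% ι_sigmaToPi_π_of_ne X (hf.ne hx.symm), zero_comp]
    · simp
  exact mono_of_mono_fac h

/-- In an abelian category satisfying AB5, the canonical morphism from a coproduct to
the product is a monomorphism. -/
lemma mono_sigmaToPi [Abelian C] [HasFilteredColimitsOfSize.{w, w} C] [AB5OfSize.{w, w} C]
    {J : Type w} [DecidableEq J] (X : J → C) [HasCoproduct X] [HasProduct X] :
    Mono (sigmaToPi X) := by
  have := IsFiltered.isConnected (Finset (Discrete J))
  let c := finiteSubcoproductsCocone X
  let φ : liftToFinsetObj (Discrete.functor X) ⟶ (Functor.const _).obj (∏ᶜ X) :=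
    c.ι ≫ (Functor.const _).map (sigmaToPi X)
  -- By AB5, a filtered colimit of the monos from finite subcoproducts is mono.
  exact MorphismProperty.colimitsOfShape_le (W := .monomorphisms C) _
    (.mk' _ _ _ _ (isColimitFiniteSubproductsCocone X) (isColimitConstCocone _ _) φ
      (fun s ↦ mono_sigmaDesc_comp_sigmaToPi X (fun x : s ↦ x.1.as)
        fun _ _ h ↦ Subtype.ext (Discrete.ext h)) _ fun _ ↦ (Category.comp_id _).symm)

end Limits

namespace ObjectProperty

variable {C : Type u} [Category.{v} C] [Abelian C] (P : ObjectProperty C)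

/-- A class of objects closed under subobjects and products in an AB5 category with products is
closed under coproducts. -/
lemma prop_sigma_of_prop_pi [P.IsClosedUnderSubobjects]
    [HasFilteredColimitsOfSize.{w, w} C] [AB5OfSize.{w, w} C]
    {J : Type w} (X : J → C) [HasCoproduct X] [HasProduct X] (h : P (∏ᶜ X)) : P (∐ X) := by
  classical
  have := mono_sigmaToPi X
  exact P.prop_of_mono (sigmaToPi X) h

variable [P.IsSerreClass]

/-- Exactness of `colim` makes it commute with kernels and cokernels. -/
lemma isoModSerre_colim_map {J : Type*} [Category* J] [HasColimitsOfShape J C]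
    [HasExactColimitsOfShape J C] (hP : ∀ F : J ⥤ C, (∀ j, P (F.obj j)) → P (colimit F))
    {F G : J ⥤ C} (α : F ⟶ G) (hα : ∀ j, P.isoModSerre (α.app j)) :
    P.isoModSerre (colim.map α) :=
  ⟨P.prop_of_iso (PreservesKernel.iso colim α) (hP _ fun j ↦
      P.prop_of_iso (PreservesKernel.iso ((evaluation J C).obj j) α).symm (hα j).1),
    P.prop_of_iso (PreservesCokernel.iso colim α) (hP _ fun j ↦
      P.prop_of_iso (PreservesCokernel.iso ((evaluation J C).obj j) α).symm (hα j).2)⟩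

namespace SerreClassLocalization

variable {D : Type*} [Category* D] (L : C ⥤ D) [L.IsLocalization P.isoModSerre]

include P in
/-- The quotient functor by a Serre class closed under coproducts preserves coproducts. -/
lemma preservesColimitsOfShape_discrete [Preadditive D] [L.Additive] (J : Type w)
    [HasColimitsOfShape (Discrete J) C] [HasExactColimitsOfShape (Discrete J) C]
    (hP : ∀ X : J → C, (∀ j, P (X j)) → P (∐ X)) :
    PreservesColimitsOfShape (Discrete J) L := by
  have := Localization.essSurj L P.isoModSerre
  have hP' (F : Discrete J ⥤ C) (hF : ∀ j, P (F.obj j)) : P (colimit F) :=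
    P.prop_of_iso (HasColimit.isoOfNatIso Discrete.natIsoFunctor).symm (hP _ fun j ↦ hF ⟨j⟩)
  have hW {X Y : J → C} (f : ∀ j, X j ⟶ Y j) (hf : ∀ j, P.isoModSerre (f j)) :
      IsIso (L.map (Limits.Sigma.map f : ∐ X ⟶ ∐ Y)) := by
    have hf :=
      P.isoModSerre_colim_map hP' (F := Discrete.functor X) (G := Discrete.functor Y)
        (Discrete.natTrans fun j ↦ f j.as) fun j ↦ hf j.as
    exact Localization.inverts L P.isoModSerre (Limits.Sigma.map f : ∐ X ⟶ ∐ Y) hf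
  suffices ∀ X : J → C, PreservesColimit (Discrete.functor X) L from
    Limits.preservesColimitsOfShape_of_discrete L
  intro X
  refine preservesColimit_of_preserves_colimit_cocone (coproductIsCoproduct X) ?_
  refine (isColimitMapCoconeCofanMkEquiv L _ _).symm ?_
  -- Write each `g j` as a right fraction; `L` inverts the coproduct of the denominators.
  have hex (T : D) (g : ∀ j, L.obj (X j) ⟶ T) :
      ∃ l : L.obj (∐ X) ⟶ T, ∀ j, L.map (Sigma.ι X j) ≫ l = g j := by
    let e := L.objObjPreimageIso T
    choose φ hφ using fun j ↦
      Localization.exists_rightFraction L P.isoModSerre (g j ≫ e.inv)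
    have := hW (fun j ↦ (φ j).s) fun j ↦ (φ j).hs
    refine ⟨inv (L.map (Limits.Sigma.map fun j ↦ (φ j).s)) ≫
      L.map (Limits.Sigma.desc fun j ↦ (φ j).f) ≫ e.hom, fun j ↦ ?_⟩
    have := Localization.inverts L P.isoModSerre _ (φ j).hs
    have h : L.map (Sigma.ι X j) ≫ inv (L.map (Limits.Sigma.map fun j ↦ (φ j).s)) =
        inv (L.map (φ j).s) ≫ L.map (Sigma.ι (fun j ↦ (φ j).X') j) := by
      rw [IsIso.comp_inv_eq, Category.assoc, IsIso.eq_inv_comp, ← L.map_comp, ← L.map_comp,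
        Limits.Sigma.ι_map]
    rw [reassoc_of% h, ← L.map_comp_assoc, Limits.Sigma.ι_desc, IsIso.inv_comp_eq,
      ← MorphismProperty.RightFraction.map_s_comp_map (φ j) L (Localization.inverts L _),
      ← hφ j]
    simp
  have hzero (T : D) (l : L.obj (∐ X) ⟶ T) (hl : ∀ j, L.map (Sigma.ι X j) ≫ l = 0) :
      l = 0 := by
    let e := L.objObjPreimageIso T
    obtain ⟨φ, hφ⟩ := Localization.exists_leftFraction L P.isoModSerre (l ≫ e.inv)
    have := Localization.inverts L P.isoModSerre _ φ.hs
    have hf : l ≫ e.inv ≫ L.map φ.s = L.map φ.f := by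
      rw [← Category.assoc, hφ, MorphismProperty.LeftFraction.map_comp_map_s]
    rw [← cancel_mono e.inv, ← cancel_mono (L.map φ.s), Category.assoc, hf, zero_comp, zero_comp]
    -- `L` kills each restriction of `φ.f`, so its image lies in `P`; `L` then inverts the coproduct
    -- of the kernel inclusions, on which `φ.f` vanishes.
    have hk (j : J) : P.isoModSerre (kernel.ι (Sigma.ι X j ≫ φ.f)) := by
      rw [isoModSerre_iff_of_mono]
      refine P.prop_of_iso (Abelian.coimageIsoImage _).symm
        ((map_eq_zero_iff L P (Sigma.ι X j ≫ φ.f)).1 ?_)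
      rw [L.map_comp, ← hf, reassoc_of% hl j, zero_comp]
    have := hW _ hk
    rw [← cancel_epi (L.map (Limits.Sigma.map fun j ↦ kernel.ι (Sigma.ι X j ≫ φ.f))), comp_zero,
      ← L.map_comp, ← L.map_zero]
    congr 1
    refine Limits.Sigma.hom_ext _ _ fun j ↦ ?_
    rw [Sigma.ι_map_assoc, kernel.condition, comp_zero]
  exact Cofan.IsColimit.mk _ (fun s ↦ (hex s.pt s.inj).choose)
    (fun s ↦ (hex s.pt s.inj).choose_spec)
    (fun s m hm ↦ sub_eq_zero.1 (hzero _ _ fun j ↦ by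
      rw [Preadditive.comp_sub, sub_eq_zero]
      exact (hm j).trans ((hex s.pt s.inj).choose_spec j).symm))

include L in
/-- If the quotient functor preserves products, the Serre class is closed under products. -/
lemma prop_pi [Preadditive D] [L.Additive] {J : Type w} (X : J → C) [HasProduct X]
    [PreservesLimit (Discrete.functor X) L] (hX : ∀ j, P (X j)) : P (∏ᶜ X) := by
  rw [← isZero_obj_iff L P, IsZero.iff_id_eq_zero]
  exact (isLimitOfPreserves L (productIsProduct X)).hom_ext fun ⟨j⟩ ↦
    ((isZero_obj_iff L P (X j)).2 (hX j)).eq_of_tgt _ _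

end SerreClassLocalization

end ObjectProperty

/-- The target of an essentially surjective right adjoint functor from a locally small
category is locally small. -/
lemma Functor.locallySmall_of_isRightAdjoint {C D : Type*} [Category* C] [Category* D]
    [LocallySmall.{w} C] (L : C ⥤ D) [L.EssSurj] [L.IsRightAdjoint] : LocallySmall.{w} D where
  hom_small X Y :=
    small_of_injective (β := L.leftAdjoint.obj X ⟶ L.objPreimage Y)
      (f := fun g ↦ ((Adjunction.ofIsRightAdjoint L).homEquiv _ _).symm
        (g ≫ (L.objObjPreimageIso Y).inv))
      fun _ _ h ↦ (cancel_mono _).1 (Equiv.injective _ h)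

/-- A colimit preserving functor from a Grothendieck abelian category to a locally small
category is a left adjoint. -/
lemma IsGrothendieckAbelian.isLeftAdjoint_of_preservesColimits {C D : Type*} [Category* C]
    [Category* D] [Abelian C] [IsGrothendieckAbelian.{w} C] [LocallySmall.{w} D] (F : C ⥤ D)
    [PreservesColimitsOfSize.{w, w} F] : F.IsLeftAdjoint := by
  -- Hom sets are moved to `Type w` for the adjoint functor theorem.
  let e := ShrinkHoms.equivalence.{w} C
  let e' := ShrinkHoms.equivalence.{w} D
  have : (e.inverse ⋙ F ⋙ e'.functor).IsLeftAdjoint :=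
    isLeftAdjoint_of_preservesColimits_of_isSeparating (isSeparator_separator (ShrinkHoms C)) _
  have : (e.functor ⋙ (e.inverse ⋙ F ⋙ e'.functor) ⋙ e'.inverse).IsLeftAdjoint := inferInstance
  exact Functor.isLeftAdjoint_of_iso (F := e.functor ⋙ (e.inverse ⋙ F ⋙ e'.functor) ⋙ e'.inverse)
    (Functor.isoWhiskerLeft (e.functor ⋙ e.inverse ⋙ F) e'.unitIso.symm ≪≫
      Functor.isoWhiskerRight e.unitIso.symm F)

end CategoryTheory

theorem corollary4p2 {A : Type u} [Category.{v} A] [Abelian A] [IsGrothendieckAbelian.{w} A]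
    (S : ObjectProperty A) [S.IsSerreClass] (hS : S.IsColocalizing) :
    S.IsLocalizing := by
  let Q := S.serreQuotientFunctor
  have : Q.IsRightAdjoint := hS
  have : Q.EssSurj := Localization.essSurj Q S.isoModSerre
  have : LocallySmall.{w} S.SerreQuotient := Q.locallySmall_of_isRightAdjoint
  have (J : Type w) : Limits.PreservesColimitsOfShape (Discrete J) Q :=
    ObjectProperty.SerreClassLocalization.preservesColimitsOfShape_discrete S Q J fun X hX ↦
      S.prop_sigma_of_prop_pi X (ObjectProperty.SerreClassLocalization.prop_pi S Q X hX)
  have := ObjectProperty.SerreClassLocalization.preservesFiniteColimits Q S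
  have : Limits.PreservesColimitsOfSize.{w, w} Q :=
    Limits.preservesColimits_of_preservesCoequalizers_and_coproducts Q
  exact IsGrothendieckAbelian.isLeftAdjoint_of_preservesColimits.{w} Q
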